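/- For integers $n\ge 0$ and $r$ let $H_n^{(r)}=\sum_{k=1}^{n}k^{-r}$, let $B_m$ denote the Bernoulli numbers, and for positive integers $a,b$ put $k_{a,b}=(-1)^a\left[\binom{a+b+1}{b}-\binom{a+b+1}{a}\right]$. For a prime $p$, a congruence $x\equiv y\pmod{p^2}$ between rational numbers means that $x=m/n$ and $y=r/s$ with integers $m,n,r,s$, where $n$ and $s$ are not divisible by $p$, and $ms\equiv nr\pmod{p^2}$. Let $p$ be a prime. 1. For every positive integer $a$ with $p\ge 2a+2$, $$\sum_{i=1}^{p-1}\left(H_i^{(a)}\right)^2\equiv-2\sum_{i=1}^{p-1}i^{-a+1}H_i^{(a)}\pmod{p^2}.$$ 2. For all positive integers $a,b$ of opposite parity with $p\ge a+b+2$, $$\sum_{i=1}^{p-1}H_i^{(a)}H_i^{(b)}\equiv-\frac{k_{a,b}}{2(a+b)}\,p\,B_{p-a-b}\pmod{p^2}.$$ -/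

import Mathlib

/-- The generalized harmonic number `H_n^{(r)} = ∑_{k=1}^n 1 / k^r`, for an integer `r`. -/
def genHarmonic (r : ℤ) (n : ℕ) : ℚ :=
  ∑ k ∈ Finset.Icc 1 n, 1 / (k : ℚ) ^ r

/-- The coefficient `k_{a,b} = (-1)^a [C(a+b+1, b) - C(a+b+1, a)]`. -/
def kCoeff (a b : ℕ) : ℤ :=
  (-1) ^ a * (((a + b + 1).choose b : ℤ) - ((a + b + 1).choose a : ℤ))

/-- Congruence of rational numbers modulo `N`: both `x = m / n` and `y = r / s` have
denominators (in lowest terms) prime to `N`, and `m s ≡ n r` modulo `N`. -/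
def RatCongr (N : ℕ) (x y : ℚ) : Prop :=
  x.den.Coprime N ∧ y.den.Coprime N ∧ x.num * (y.den : ℤ) ≡ (x.den : ℤ) * y.num [ZMOD (N : ℤ)]

/-! Everything is computed in `ZMod (p ^ 2)`, where `p * x` depends only on `x` mod `p`. Write
S(a,b) for the sum of H_i^(a) H_i^(b) over 0 < i < p. Summation by parts (`modProduct_succ_succ`)
expresses S(a,b) by double sums ∑ i^(-x) H_i^(d) and H_{p-1}^(a+b-1). For a = b the latter has odd
weight and vanishes mod p², as does p (H_{p-1}^(a))², which is part 1. For part 2 take a even, b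
odd. The reflection i ↦ p-1-i returns -S(a,b) up to correction terms, so 2 S(a,b) equals p times
sums of weight a+b+1, minus H_{p-1}^(a) H_{p-1}^(b-1) (`two_mul_modProduct`). Under the factor p,
summation by parts, Fermat and Faulhaber turn these sums into multiples of B_{p-a-b}
(`add_mul_prime_mul_modDouble`). The last product vanishes unless b = 1; then H_{p-1}^(a) is needed
mod p², and Newton's identities with Wilson's theorem supply it (`succ_mul_modHarmonic_of_even`).
`kCoeff_identity` collects the binomials. -/

/-- The rational number `x` is integral at `p` and reduces to `c` modulo `p ^ 2`. -/
def ReducesTo (p : ℕ) (x : ℚ) (c : ZMod (p ^ 2)) : Prop :=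
  x.den.Coprime p ∧ (x.num : ZMod (p ^ 2)) = c * (x.den : ZMod (p ^ 2))

/-! ### Reduction of p-integral rationals modulo p². -/

section Reduction

variable {p : ℕ}

theorem isUnit_natCast_of_coprime {n : ℕ} (h : n.Coprime p) : IsUnit (n : ZMod (p ^ 2)) :=
  (ZMod.isUnit_iff_coprime n (p ^ 2)).2 (h.pow_right 2)

theorem ReducesTo.of_div {x : ℚ} {c : ZMod (p ^ 2)} {m : ℤ} {n : ℕ} (hn0 : n ≠ 0)
    (hn : n.Coprime p) (hx : x = m / n) (hc : (m : ZMod (p ^ 2)) = c * (n : ZMod (p ^ 2))) :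
    ReducesTo p x c := by
  have hdvd : (x.den : ℤ) ∣ n := by
    rw [hx]
    have := Rat.den_dvd m n
    rwa [Rat.divInt_eq_div, Int.cast_natCast] at this
  have hden : x.den.Coprime p := Nat.Coprime.coprime_dvd_left (by exact_mod_cast hdvd) hn
  refine ⟨hden, ?_⟩
  have hz : x.num * (n : ℤ) = m * (x.den : ℤ) := by
    have h1 : (x.num : ℚ) / x.den = m / n := by rw [Rat.num_div_den, hx]
    have h2 : (x.den : ℚ) ≠ 0 := by exact_mod_cast x.den_nz
    have h3 : (n : ℚ) ≠ 0 := by exact_mod_cast hn0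
    rw [div_eq_div_iff h2 h3] at h1
    exact_mod_cast h1
  have hz' : (x.num : ZMod (p ^ 2)) * n = m * x.den := by exact_mod_cast congrArg (Int.cast : ℤ → ZMod (p ^ 2)) hz
  refine (isUnit_natCast_of_coprime hn).mul_right_cancel ?_
  rw [hz', hc]; ring

theorem ReducesTo.unique {x : ℚ} {c d : ZMod (p ^ 2)} (h : ReducesTo p x c)
    (h' : ReducesTo p x d) : c = d :=
  (isUnit_natCast_of_coprime h.1).mul_right_cancel (h.2.symm.trans h'.2)

theorem ReducesTo.ratCongr {x y : ℚ} {c : ZMod (p ^ 2)} (hx : ReducesTo p x c)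
    (hy : ReducesTo p y c) : RatCongr (p ^ 2) x y := by
  refine ⟨hx.1.pow_right 2, hy.1.pow_right 2, ?_⟩
  rw [← ZMod.intCast_eq_intCast_iff]
  push_cast
  rw [hx.2, hy.2]; ring

theorem ReducesTo.intCast (m : ℤ) : ReducesTo p (m : ℚ) m := by
  simp [ReducesTo]

theorem ReducesTo.natCast (m : ℕ) : ReducesTo p (m : ℚ) m := by
  simp [ReducesTo]

theorem ReducesTo.add {x y : ℚ} {c d : ZMod (p ^ 2)} (hx : ReducesTo p x c)
    (hy : ReducesTo p y d) : ReducesTo p (x + y) (c + d) := by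
  refine .of_div (m := x.num * y.den + y.num * x.den) (n := x.den * y.den)
    (mul_ne_zero x.den_nz y.den_nz) (hx.1.mul_left hy.1) ?_ ?_
  · have h2 : (x.den : ℚ) ≠ 0 := by exact_mod_cast x.den_nz
    have h3 : (y.den : ℚ) ≠ 0 := by exact_mod_cast y.den_nz
    conv_lhs => rw [← Rat.num_div_den x, ← Rat.num_div_den y]
    push_cast
    field_simp
  · push_cast
    rw [hx.2, hy.2]; ring

theorem ReducesTo.mul {x y : ℚ} {c d : ZMod (p ^ 2)} (hx : ReducesTo p x c)
    (hy : ReducesTo p y d) : ReducesTo p (x * y) (c * d) := by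
  refine .of_div (m := x.num * y.num) (n := x.den * y.den)
    (mul_ne_zero x.den_nz y.den_nz) (hx.1.mul_left hy.1) ?_ ?_
  · conv_lhs => rw [← Rat.num_div_den x, ← Rat.num_div_den y]
    push_cast
    rw [div_mul_div_comm]
  · push_cast
    rw [hx.2, hy.2]; ring

theorem ReducesTo.neg {x : ℚ} {c : ZMod (p ^ 2)} (hx : ReducesTo p x c) :
    ReducesTo p (-x) (-c) := by
  simpa using (ReducesTo.intCast (p := p) (-1)).mul hx

theorem ReducesTo.pow {x : ℚ} {c : ZMod (p ^ 2)} (hx : ReducesTo p x c) (n : ℕ) :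
    ReducesTo p (x ^ n) (c ^ n) := by
  induction n with
  | zero => simpa using ReducesTo.natCast (p := p) 1
  | succ n ih => simpa [pow_succ] using ih.mul hx

theorem ReducesTo.sum {ι : Type*} {s : Finset ι} {f : ι → ℚ} {g : ι → ZMod (p ^ 2)}
    (h : ∀ i ∈ s, ReducesTo p (f i) (g i)) :
    ReducesTo p (∑ i ∈ s, f i) (∑ i ∈ s, g i) := by
  classical
  induction s using Finset.induction_on with
  | empty => simpa using ReducesTo.natCast (p := p) 0
  | insert a s ha ih =>
    rw [Finset.sum_insert ha, Finset.sum_insert ha]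
    exact (h a (by simp)).add (ih fun i hi => h i (by simp [hi]))

theorem ReducesTo.inv_natCast {n : ℕ} (hn0 : n ≠ 0) (hn : n.Coprime p) :
    ReducesTo p ((n : ℚ)⁻¹) ((n : ZMod (p ^ 2))⁻¹) := by
  refine .of_div (m := 1) hn0 hn (by simp) ?_
  rw [Int.cast_one, ZMod.inv_mul_of_unit _ (isUnit_natCast_of_coprime hn)]

theorem coprime_of_pos_of_lt (hp : p.Prime) {k : ℕ} (h0 : 0 < k) (h1 : k < p) : k.Coprime p :=
  Nat.Coprime.symm ((hp.coprime_iff_not_dvd).2 (Nat.not_dvd_of_pos_of_lt h0 h1))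

/-- Bernoulli numbers of index below `p - 1` are integral at `p`. -/
theorem exists_reducesTo_bernoulli' (hp : p.Prime) (n : ℕ) (hn : n + 1 < p) :
    ∃ c, ReducesTo p (bernoulli' n) c := by
  induction n using Nat.strong_induction_on with
  | _ n ih =>
    choose! c hc using ih
    rw [bernoulli'_def]
    refine ⟨_, sub_eq_add_neg (1 : ℚ) _ ▸ ReducesTo.add (c := ((1 : ℕ) : ZMod (p ^ 2))) ?_ (ReducesTo.neg (ReducesTo.sum
      (g := fun k => (n.choose k : ZMod (p ^ 2)) * ((n - k + 1 : ℕ) : ZMod (p ^ 2))⁻¹ * c k) ?_))⟩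
    · simpa using ReducesTo.natCast (p := p) 1
    · intro k hk
      have hk' := Finset.mem_range.1 hk
      -- The denominators n - k + 1 of the recursion are at most n + 1 < p.
      have h := ((ReducesTo.natCast (p := p) (n.choose k)).mul (ReducesTo.inv_natCast
        (Nat.succ_ne_zero (n - k)) (coprime_of_pos_of_lt hp (Nat.succ_pos _) (by omega)))).mul (hc k hk' (by omega))
      convert h using 2
      rw [div_eq_mul_inv]
      push_cast [Nat.cast_sub hk'.le]
      rfl

theorem exists_reducesTo_bernoulli (hp : p.Prime) (n : ℕ) (hn : n + 1 < p) :
    ∃ c, ReducesTo p (bernoulli n) c := by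
  obtain ⟨c, hc⟩ := exists_reducesTo_bernoulli' hp n hn
  have h := ((ReducesTo.intCast (p := p) (-1)).pow n).mul hc
  exact ⟨_, by simpa [bernoulli] using h⟩

end Reduction

/-! ### Summation by parts and first-order expansion in a commutative ring. -/

section SummationByParts

variable {A : Type*} [CommRing A]

theorem sum_partialSum (f : ℕ → A) (n : ℕ) :
    ∑ i ∈ Finset.Icc 1 n, ∑ j ∈ Finset.Icc 1 i, f j =
      (n + 1) * ∑ j ∈ Finset.Icc 1 n, f j - ∑ i ∈ Finset.Icc 1 n, i * f i := by
  induction n with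
  | zero => simp
  | succ n ih =>
    simp only [Finset.sum_Icc_succ_top (Nat.succ_le_succ (Nat.zero_le n)), ih]
    push_cast
    ring

theorem sum_partialSum_mul_partialSum (f g : ℕ → A) (n : ℕ) :
    ∑ i ∈ Finset.Icc 1 n, (∑ j ∈ Finset.Icc 1 i, f j) * ∑ j ∈ Finset.Icc 1 i, g j =
      (n + 1) * ((∑ j ∈ Finset.Icc 1 n, f j) * ∑ j ∈ Finset.Icc 1 n, g j) -
        ∑ i ∈ Finset.Icc 1 n, i * f i * (∑ j ∈ Finset.Icc 1 i, g j) -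
        ∑ i ∈ Finset.Icc 1 n, i * g i * (∑ j ∈ Finset.Icc 1 i, f j) +
        ∑ i ∈ Finset.Icc 1 n, i * f i * g i := by
  induction n with
  | zero => simp
  | succ n ih =>
    simp only [Finset.sum_Icc_succ_top (Nat.succ_le_succ (Nat.zero_le n)), ih]
    push_cast
    ring

/-- Binomial expansion to first order; the extra factor `x` avoids the exponent `n - 1`. -/
theorem add_mul_pow_of_sq_eq_zero {P : A} (hP : P ^ 2 = 0) (x y : A) (n : ℕ) :
    (x + P * y) ^ n * x = x ^ n * (x + n * (P * y)) := by
  induction n with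
  | zero => simp
  | succ n ih =>
    have : (x + P * y) ^ (n + 1) * x = ((x + P * y) ^ n * x) * (x + P * y) := by ring
    rw [this, ih]
    push_cast
    linear_combination x ^ n * n * y ^ 2 * hP

end SummationByParts

/-! ### Power sums and harmonic numbers modulo p². -/

section PrimeSquare

variable {p : ℕ}

theorem cast_prime_sq : (p : ZMod (p ^ 2)) ^ 2 = 0 := by
  rw [← Nat.cast_pow, ZMod.natCast_self]

theorem prime_mul_eq_zero_iff (hp : p.Prime) (x : ZMod (p ^ 2)) :
    (p : ZMod (p ^ 2)) * x = 0 ↔ ZMod.castHom (dvd_pow_self p two_ne_zero) (ZMod p) x = 0 := by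
  obtain ⟨n, rfl⟩ := ZMod.intCast_surjective x
  rw [map_intCast, ZMod.intCast_zmod_eq_zero_iff_dvd, ← Int.cast_natCast p, ← Int.cast_mul,
    ZMod.intCast_zmod_eq_zero_iff_dvd, Nat.cast_pow, pow_two]
  exact mul_dvd_mul_iff_left (by exact_mod_cast hp.ne_zero)

theorem exists_eq_prime_mul (hp : p.Prime) {x : ZMod (p ^ 2)} (h : (p : ZMod (p ^ 2)) * x = 0) :
    ∃ y, x = p * y := by
  rw [prime_mul_eq_zero_iff hp] at h
  obtain ⟨n, rfl⟩ := ZMod.intCast_surjective x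
  rw [map_intCast, ZMod.intCast_zmod_eq_zero_iff_dvd] at h
  obtain ⟨m, rfl⟩ := h
  exact ⟨m, by push_cast; rfl⟩

theorem mul_eq_zero_of_prime_mul (hp : p.Prime) {x y : ZMod (p ^ 2)}
    (hx : (p : ZMod (p ^ 2)) * x = 0) (hy : (p : ZMod (p ^ 2)) * y = 0) : x * y = 0 := by
  obtain ⟨z, rfl⟩ := exists_eq_prime_mul hp hx
  rw [mul_right_comm, hy, zero_mul]

theorem isUnit_of_pos_of_lt (hp : p.Prime) {k : ℕ} (h0 : 0 < k) (h1 : k < p) :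
    IsUnit (k : ZMod (p ^ 2)) :=
  isUnit_natCast_of_coprime (coprime_of_pos_of_lt hp h0 h1)

theorem mul_inv_of_pos_of_lt (hp : p.Prime) {k : ℕ} (h0 : 0 < k) (h1 : k < p) :
    (k : ZMod (p ^ 2)) * (k : ZMod (p ^ 2))⁻¹ = 1 :=
  ZMod.mul_inv_of_unit _ (isUnit_of_pos_of_lt hp h0 h1)

theorem prime_mul_pow_sub_one (hp : p.Prime) {k : ℕ} (h0 : 0 < k) (h1 : k < p) :
    (p : ZMod (p ^ 2)) * (k : ZMod (p ^ 2)) ^ (p - 1) = p := by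
  have := Fact.mk hp
  rw [← sub_eq_zero, ← mul_sub_one, prime_mul_eq_zero_iff hp, map_sub, map_pow, map_natCast,
    map_one, ZMod.pow_card_sub_one_eq_one, sub_self]
  rw [Ne, ZMod.natCast_eq_zero_iff]
  exact Nat.not_dvd_of_pos_of_lt h0 h1

/-- Fermat's little theorem, usable under a factor p: negative powers become nonnegative ones, to
which Faulhaber's formula applies. -/
theorem prime_mul_inv_pow (hp : p.Prime) {k d : ℕ} (h0 : 0 < k) (h1 : k < p) (hd : d ≤ p - 1) :
    (p : ZMod (p ^ 2)) * (k : ZMod (p ^ 2))⁻¹ ^ d = p * (k : ZMod (p ^ 2)) ^ (p - 1 - d) := by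
  have h := mul_inv_of_pos_of_lt hp h0 h1
  rw [← prime_mul_pow_sub_one hp h0 h1]
  nth_rewrite 1 [← Nat.sub_add_cancel hd]
  rw [pow_add, mul_assoc, mul_assoc, ← mul_pow, h, one_pow, mul_one]
  rw [prime_mul_pow_sub_one hp h0 h1]

theorem sum_pow_zmod (hp : p.Prime) (e : ℕ) :
    ∑ k ∈ Finset.Icc 1 (p - 1), (k : ZMod p) ^ e = if p - 1 ∣ e then -1 else 0 := by
  have := Fact.mk hp
  have h := FiniteField.sum_pow_units (ZMod p) e
  rw [ZMod.card] at h
  rw [← h]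
  symm
  refine Finset.sum_bij (fun x _ => (x : ZMod p).val) ?_ ?_ ?_ ?_
  · intro x _
    have h1 := ZMod.val_lt (x : ZMod p)
    have h2 : (x : ZMod p).val ≠ 0 := by simp
    rw [Finset.mem_Icc]; omega
  · intro x _ y _ hxy
    exact Units.ext (ZMod.val_injective p hxy)
  · intro k hk
    rw [Finset.mem_Icc] at hk
    have hk0 : (k : ZMod p) ≠ 0 := by
      rw [Ne, ZMod.natCast_eq_zero_iff]
      exact Nat.not_dvd_of_pos_of_lt hk.1 (by omega)
    exact ⟨Units.mk0 _ hk0, Finset.mem_univ _, ZMod.val_cast_of_lt (by omega)⟩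
  · intro x _
    rw [ZMod.natCast_zmod_val]

theorem prime_mul_sum_pow (hp : p.Prime) (e : ℕ) :
    (p : ZMod (p ^ 2)) * ∑ k ∈ Finset.Icc 1 (p - 1), (k : ZMod (p ^ 2)) ^ e =
      if p - 1 ∣ e then -(p : ZMod (p ^ 2)) else 0 := by
  have h := sum_pow_zmod hp e
  split_ifs at h ⊢ with hd
  · rw [← sub_eq_zero, sub_neg_eq_add, ← mul_add_one, prime_mul_eq_zero_iff hp]
    simp only [map_add, map_sum, map_pow, map_natCast, map_one, h]
    ring
  · rw [prime_mul_eq_zero_iff hp]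
    simpa only [map_sum, map_pow, map_natCast] using h

/-- The generalized harmonic number `H_n^{(a)}` as an element of `ZMod (p ^ 2)`. -/
def modHarmonic (p a n : ℕ) : ZMod (p ^ 2) :=
  ∑ k ∈ Finset.Icc 1 n, (k : ZMod (p ^ 2))⁻¹ ^ a

theorem prime_mul_modHarmonic (hp : p.Prime) {a : ℕ} (h0 : 0 < a) (h1 : a < p - 1) :
    (p : ZMod (p ^ 2)) * modHarmonic p a (p - 1) = 0 := by
  rw [modHarmonic, Finset.mul_sum, Finset.sum_congr rfl fun k hk => prime_mul_inv_pow hp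
    (Finset.mem_Icc.1 hk).1 (by have := (Finset.mem_Icc.1 hk).2; have := hp.two_le; omega) h1.le,
    ← Finset.mul_sum, prime_mul_sum_pow hp, if_neg]
  exact Nat.not_dvd_of_pos_of_lt (by omega) (by omega)

theorem inv_prime_sub_pow (hp : p.Prime) {k : ℕ} (h0 : 0 < k) (h1 : k < p) (a : ℕ) :
    ((p - k : ℕ) : ZMod (p ^ 2))⁻¹ ^ a = (-1) ^ a * ((k : ZMod (p ^ 2))⁻¹ ^ a +
      a * (p * (k : ZMod (p ^ 2))⁻¹ ^ (a + 1))) := by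
  have hk := mul_inv_of_pos_of_lt hp h0 h1
  have hk' := mul_inv_of_pos_of_lt hp (k := p - k) (by omega) (by omega)
  have hP := cast_prime_sq (p := p)
  rw [Nat.cast_sub h1.le] at hk' ⊢
  set P := (p : ZMod (p ^ 2))
  set u := (k : ZMod (p ^ 2))⁻¹
  set v := (P - k)⁻¹
  have hv : v = -(u + P * u ^ 2) := by
    linear_combination (-(u + P * u ^ 2)) * hk' - v * (1 + P * u) * hk + v * u ^ 2 * hP
  have hpow := add_mul_pow_of_sq_eq_zero hP u (u ^ 2) a
  have : (u + P * u ^ 2) ^ a = u ^ a + a * (P * u ^ (a + 1)) := by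
    -- Multiplying by k cancels the extra factor u = k⁻¹ in `hpow`.
    linear_combination k * hpow + (u ^ a + a * (P * u ^ (a + 1)) - (u + P * u ^ 2) ^ a) * hk
  rw [hv, neg_pow, this]

/-- The terms missing from the full sum are those at p - k with k ≤ i, each expanded by
`inv_prime_sub_pow`. -/
theorem modHarmonic_reflect (hp : p.Prime) (a : ℕ) {i : ℕ} (hi : i < p) :
    modHarmonic p a (p - 1 - i) = modHarmonic p a (p - 1) -
      (-1) ^ a * (modHarmonic p a i + a * (p * modHarmonic p (a + 1) i)) := by
  induction i with
  | zero => simp [modHarmonic]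
  | succ i ih =>
    have h := ih (by omega)
    have e : p - 1 - i = (p - 1 - (i + 1)) + 1 := by omega
    have h2 := inv_prime_sub_pow hp (k := i + 1) (by omega) hi a
    have e2 : p - 1 - (i + 1) + 1 = p - (i + 1) := by omega
    unfold modHarmonic at h ⊢
    rw [e, Finset.sum_Icc_succ_top (by omega), e2, h2] at h
    rw [Finset.sum_Icc_succ_top (by omega : 1 ≤ i + 1), Finset.sum_Icc_succ_top (by omega : 1 ≤ i + 1)]
    linear_combination h

/-- Reflection at i = p - 1 gives 0 = 2 H_{p-1}^(a), since p H_{p-1}^(a+1) vanishes. -/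
theorem modHarmonic_eq_zero_of_odd (hp : p.Prime) {a : ℕ} (ha : Odd a) (h : a + 2 < p) :
    modHarmonic p a (p - 1) = 0 := by
  have h1 := modHarmonic_reflect hp a (i := p - 1) (by have := hp.two_le; omega)
  rw [ha.neg_one_pow, prime_mul_modHarmonic hp (a := a + 1) (by omega) (by omega)] at h1
  have h0 : modHarmonic p a (p - 1 - (p - 1)) = 0 := by simp [modHarmonic]
  rw [h0] at h1
  have h2 : IsUnit ((2 : ℕ) : ZMod (p ^ 2)) := isUnit_of_pos_of_lt hp two_pos (by omega)
  refine h2.mul_left_cancel ?_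
  push_cast
  linear_combination -h1

end PrimeSquare

/-! ### Faulhaber's formula, double sums and reflected product sums. -/

section Bernoulli

variable {p : ℕ}

/-- The reduction modulo `p ^ 2` of a Bernoulli number; meaningful if that number is integral
at `p`. -/
noncomputable def modBernoulli (p n : ℕ) : ZMod (p ^ 2) :=
  ((bernoulli n).num : ZMod (p ^ 2)) * ((bernoulli n).den : ZMod (p ^ 2))⁻¹

theorem reducesTo_bernoulli (hp : p.Prime) {n : ℕ} (hn : n + 1 < p) :
    ReducesTo p (bernoulli n) (modBernoulli p n) := by
  obtain ⟨c, hc⟩ := exists_reducesTo_bernoulli hp n hn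
  refine ⟨hc.1, ?_⟩
  rw [modBernoulli, mul_assoc, ZMod.inv_mul_of_unit _ (isUnit_natCast_of_coprime hc.1), mul_one]

theorem mod_sum_range_pow (hp : p.Prime) {m : ℕ} (hm : m + 1 < p) (n : ℕ) :
    ((m + 1 : ℕ) : ZMod (p ^ 2)) * ∑ k ∈ Finset.range n, (k : ZMod (p ^ 2)) ^ m =
      ∑ i ∈ Finset.range (m + 1),
        modBernoulli p i * ((m + 1).choose i) * (n : ZMod (p ^ 2)) ^ (m + 1 - i) := by
  have h1 := (ReducesTo.natCast (p := p) (m + 1)).mul (ReducesTo.sum (s := Finset.range n)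
    fun k _ => (ReducesTo.natCast (p := p) k).pow m)
  have h2 := ReducesTo.sum (s := Finset.range (m + 1)) fun i hi =>
    ((reducesTo_bernoulli hp (n := i) (by have := Finset.mem_range.1 hi; omega)).mul
      (ReducesTo.natCast (p := p) ((m + 1).choose i))).mul
        ((ReducesTo.natCast (p := p) n).pow (m + 1 - i))
  refine h1.unique ?_
  convert h2 using 1
  rw [sum_range_pow, ← Finset.sum_div, Nat.cast_succ, mul_div_cancel₀]
  exact Nat.cast_add_one_ne_zero m

theorem sum_range_prime_pow (hp : p.Prime) {m : ℕ} (hm : m + 1 < p) :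
    ∑ k ∈ Finset.range p, (k : ZMod (p ^ 2)) ^ m = p * modBernoulli p m := by
  refine (isUnit_of_pos_of_lt hp (Nat.succ_pos m) hm).mul_left_cancel ?_
  rw [Nat.succ_eq_add_one, mod_sum_range_pow hp hm, Finset.sum_range_succ, Finset.sum_eq_zero]
  · rw [Nat.choose_succ_self_right, Nat.add_sub_cancel_left, pow_one]
    ring
  · intro i hi
    -- Every term but the last carries p².
    have : m + 1 - i = 2 + (m - 1 - i) := by have := Finset.mem_range.1 hi; omega
    rw [this, pow_add, cast_prime_sq, zero_mul, mul_zero]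

/-- Modulo p the upper entry p - d acts as -d, and C(-d, j) = (-1)^j C(d+j-1, j). -/
theorem prime_mul_choose_sub (hp : p.Prime) {d : ℕ} (hd : 0 < d) {j : ℕ} (h : d + j ≤ p) :
    (p : ZMod (p ^ 2)) * ((p - d).choose j : ℕ) = p * ((-1) ^ j * ((d + j - 1).choose j : ℕ)) := by
  induction j with
  | zero => simp
  | succ j ih =>
    refine (isUnit_of_pos_of_lt hp (Nat.succ_pos j) (by omega)).mul_left_cancel ?_
    have h1 : ((p - d).choose (j + 1) : ZMod (p ^ 2)) * (j + 1) = (p - d).choose j * (p - d - j) := by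
      have := congrArg (Nat.cast : ℕ → ZMod (p ^ 2)) (Nat.choose_succ_right_eq (p - d) j)
      rw [Nat.cast_mul, Nat.cast_mul, Nat.cast_sub (by omega), Nat.cast_sub (by omega)] at this
      exact_mod_cast this
    have h2 : ((d + j).choose (j + 1) : ZMod (p ^ 2)) * (j + 1) = (d + j) * (d + j - 1).choose j := by
      have := congrArg (Nat.cast : ℕ → ZMod (p ^ 2)) (Nat.add_one_mul_choose_eq (d + j - 1) j)
      rw [Nat.sub_add_cancel (by omega)] at this
      push_cast at this
      exact this.symm
    have h3 := ih (by omega)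
    have hP := cast_prime_sq (p := p)
    rw [show d + (j + 1) - 1 = d + j by omega]
    push_cast
    linear_combination (p : ZMod (p ^ 2)) * h1 + p * (-1) ^ j * h2 - (d + j : ZMod (p ^ 2)) * h3 +
      ((p - d).choose j : ZMod (p ^ 2)) * hP

/-- The double sum `∑ i ^ (-x) * H_i^{(d)}` over `1 ≤ i < p`, modulo `p ^ 2`. -/
def modDouble (p x d : ℕ) : ZMod (p ^ 2) :=
  ∑ i ∈ Finset.Icc 1 (p - 1), (i : ZMod (p ^ 2))⁻¹ ^ x * modHarmonic p d i

theorem prime_mul_modHarmonic_eq_sum_pow (hp : p.Prime) {d : ℕ} (hd : d + 1 < p) {i : ℕ}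
    (hi : i < p) :
    (p : ZMod (p ^ 2)) * modHarmonic p d i =
      p * (∑ j ∈ Finset.range i, (j : ZMod (p ^ 2)) ^ (p - 1 - d) + (i : ZMod (p ^ 2)) ^ (p - 1 - d)) := by
  rw [← Finset.sum_range_succ, Finset.range_eq_Ico, Finset.sum_eq_sum_Ico_succ_bot (Nat.succ_pos i),
    Nat.cast_zero, zero_pow (by omega), zero_add, modHarmonic, Finset.mul_sum, Finset.mul_sum]
  refine Finset.sum_congr rfl fun k hk => ?_
  have := Finset.mem_Icc.1 hk
  exact prime_mul_inv_pow hp this.1 (by omega) (by omega)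

/-- Expanding the inner sum by Faulhaber leaves power sums over i, which vanish mod p unless p - 1
divides the exponent; only the Bernoulli index p - x - d survives. -/
theorem prime_mul_modDouble (hp : p.Prime) {x d : ℕ} (hx : 0 < x) (hd : 0 < d)
    (h : x + d + 2 ≤ p) :
    (d : ZMod (p ^ 2)) * (p * modDouble p x d) =
      p * modBernoulli p (p - x - d) * ((p - d).choose x : ℕ) := by
  have hP := cast_prime_sq (p := p)
  set P := (p : ZMod (p ^ 2)) with hPdef
  have h1 : P * modDouble p x d = ∑ i ∈ Finset.Icc 1 (p - 1),
      P * (i : ZMod (p ^ 2)) ^ (p - 1 - x) * ∑ j ∈ Finset.range i, (j : ZMod (p ^ 2)) ^ (p - 1 - d) := by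
    -- The diagonal j = i contributes nothing: its exponent 2(p-1) - x - d lies strictly between p -
    -- 1 and 2(p-1).
    have h0 : P * ∑ i ∈ Finset.Icc 1 (p - 1), (i : ZMod (p ^ 2)) ^ (p - 1 - x + (p - 1 - d)) = 0 := by
      rw [prime_mul_sum_pow hp, if_neg]
      rintro ⟨t, ht⟩
      rcases t with - | - | t
      · omega
      · omega
      · have : (p - 1) * 2 ≤ (p - 1) * (t + 1 + 1) := Nat.mul_le_mul_left _ (by omega)
        omega
    rw [modDouble, Finset.mul_sum, ← add_zero (∑ i ∈ _, _ * ∑ j ∈ _, _), ← h0, Finset.mul_sum,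
      ← Finset.sum_add_distrib]
    refine Finset.sum_congr rfl fun i hi => ?_
    have hi' := Finset.mem_Icc.1 hi
    have e1 := prime_mul_inv_pow hp (d := x) hi'.1 (by omega) (by omega)
    have e2 := prime_mul_modHarmonic_eq_sum_pow hp (d := d) (by omega) (i := i) (by omega)
    rw [pow_add]
    linear_combination modHarmonic p d i * e1 + (i : ZMod (p ^ 2)) ^ (p - 1 - x) * e2
  have h2 : ((p - 1 - d + 1 : ℕ) : ZMod (p ^ 2)) = P - d := by
    rw [← Nat.cast_sub (by omega)]
    congr 1
    omega
  have h3 : (P - d) * (P * modDouble p x d) = ∑ k ∈ Finset.range (p - 1 - d + 1),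
      modBernoulli p k * ((p - d).choose k : ℕ) * (P * ∑ i ∈ Finset.Icc 1 (p - 1),
        (i : ZMod (p ^ 2)) ^ (p - 1 - x + (p - d - k))) := by
    rw [h1, ← h2, Finset.mul_sum]
    simp only [Finset.mul_sum (Finset.Icc 1 (p - 1))]
    rw [Finset.sum_comm]
    refine Finset.sum_congr rfl fun i _ => ?_
    rw [mul_left_comm, mod_sum_range_pow hp (by omega), Finset.mul_sum]
    refine Finset.sum_congr rfl fun k _ => ?_
    rw [show p - 1 - d + 1 = p - d by omega, pow_add]
    ring
  rw [Finset.sum_eq_single_of_mem (p - x - d) (Finset.mem_range.2 (by omega))] at h3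
  · rw [prime_mul_sum_pow hp, if_pos ⟨1, by omega⟩,
      show p - x - d = (p - d) - x by omega, Nat.choose_symm (by omega)] at h3
    rw [show p - x - d = (p - d) - x by omega]
    linear_combination modDouble p x d * hP - h3
  · intro k hk hne
    have := Finset.mem_range.1 hk
    rw [prime_mul_sum_pow hp, if_neg, mul_zero]
    rintro ⟨t, ht⟩
    rcases t with - | - | t
    · omega
    · omega
    · have : (p - 1) * 2 ≤ (p - 1) * (t + 1 + 1) := Nat.mul_le_mul_left _ (by omega)
      omega

theorem add_mul_prime_mul_modDouble (hp : p.Prime) {x d : ℕ} (hx : 0 < x) (hd : 0 < d)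
    (h : x + d + 2 ≤ p) :
    ((x + d : ℕ) : ZMod (p ^ 2)) * (p * modDouble p x d) =
      (-1) ^ x * ((x + d).choose d : ℕ) * (p * modBernoulli p (p - x - d)) := by
  refine (isUnit_of_pos_of_lt hp hd (by omega)).mul_left_cancel ?_
  have h1 := prime_mul_modDouble hp hx hd h
  have h2 := prime_mul_choose_sub hp hd (j := x) (by omega)
  have h3 : ((x + d : ℕ) : ZMod (p ^ 2)) * ((d + x - 1).choose x : ℕ) = d * ((x + d).choose d : ℕ) := by
    have := Nat.add_one_mul_choose_eq (x + d - 1) (d - 1)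
    rw [Nat.sub_add_cancel (by omega), Nat.sub_add_cancel hd,
      ← Nat.choose_symm (by omega : d - 1 ≤ x + d - 1),
      show x + d - 1 - (d - 1) = x by omega, mul_comm _ d, add_comm x d] at this
    rw [add_comm x d]
    exact_mod_cast congrArg (Nat.cast : ℕ → ZMod (p ^ 2)) this
  linear_combination ((x + d : ℕ) : ZMod (p ^ 2)) * h1 +
    ((x + d : ℕ) : ZMod (p ^ 2)) * modBernoulli p (p - x - d) * h2 +
    p * modBernoulli p (p - x - d) * (-1) ^ x * h3

theorem sum_modHarmonic (hp : p.Prime) {d : ℕ} (hd : 0 < d) :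
    modDouble p 0 d = p * modHarmonic p d (p - 1) - modHarmonic p (d - 1) (p - 1) := by
  have h := sum_partialSum (fun k : ℕ => (k : ZMod (p ^ 2))⁻¹ ^ d) (p - 1)
  have e : ((p - 1 : ℕ) : ZMod (p ^ 2)) + 1 = p := by
    rw [← Nat.cast_succ, Nat.succ_eq_add_one, Nat.sub_add_cancel hp.one_le]
  rw [e] at h
  simp only [modDouble, modHarmonic, pow_zero, one_mul, h]
  congr 1
  refine Finset.sum_congr rfl fun i hi => ?_
  have hi' := Finset.mem_Icc.1 hi
  have h1 := mul_inv_of_pos_of_lt hp hi'.1 (by omega)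
  have h2 := pow_sub_one_mul hd.ne' (i : ZMod (p ^ 2))⁻¹
  linear_combination (i : ZMod (p ^ 2))⁻¹ ^ (d - 1) * h1 - (i : ZMod (p ^ 2)) * h2

/-- The sum of the products `H_i^{(a)} H_i^{(b)}` over `1 ≤ i < p`, modulo `p ^ 2`. -/
def modProduct (p a b : ℕ) : ZMod (p ^ 2) :=
  ∑ i ∈ Finset.Icc 1 (p - 1), modHarmonic p a i * modHarmonic p b i

theorem modProduct_comm (a b : ℕ) : modProduct p a b = modProduct p b a :=
  Finset.sum_congr rfl fun _ _ => mul_comm _ _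

theorem modProduct_succ_succ (hp : p.Prime) {a b : ℕ} :
    modProduct p (a + 1) (b + 1) =
      p * (modHarmonic p (a + 1) (p - 1) * modHarmonic p (b + 1) (p - 1)) -
        modDouble p a (b + 1) - modDouble p b (a + 1) + modHarmonic p (a + b + 1) (p - 1) := by
  have h := sum_partialSum_mul_partialSum (fun k : ℕ => (k : ZMod (p ^ 2))⁻¹ ^ (a + 1))
    (fun k : ℕ => (k : ZMod (p ^ 2))⁻¹ ^ (b + 1)) (p - 1)
  have e : ((p - 1 : ℕ) : ZMod (p ^ 2)) + 1 = p := by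
    rw [← Nat.cast_succ, Nat.succ_eq_add_one, Nat.sub_add_cancel hp.one_le]
  have e2 (c i : ℕ) (hi : i ∈ Finset.Icc 1 (p - 1)) :
      (i : ZMod (p ^ 2)) * (i : ZMod (p ^ 2))⁻¹ ^ (c + 1) = (i : ZMod (p ^ 2))⁻¹ ^ c := by
    have hi' := Finset.mem_Icc.1 hi
    linear_combination (i : ZMod (p ^ 2))⁻¹ ^ c * mul_inv_of_pos_of_lt hp hi'.1 (by omega)
  rw [e] at h
  simp only [modProduct, modDouble, modHarmonic, h]
  congr 1
  · congr 1
    · congr 1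
      exact Finset.sum_congr rfl fun i hi => by rw [e2 a i hi]
    · exact Finset.sum_congr rfl fun i hi => by rw [e2 b i hi]
  · exact Finset.sum_congr rfl fun i hi => by rw [e2 a i hi]; ring

theorem two_mul_modProduct (hp : p.Prime) {a b : ℕ} (ha : Even a) (hb : Odd b) (ha0 : 0 < a)
    (h : a + b + 2 ≤ p) :
    2 * modProduct p a b = -(p * (a * modProduct p (a + 1) b + b * modProduct p a (b + 1))) -
      modHarmonic p a (p - 1) * modHarmonic p (b - 1) (p - 1) := by
  have hb0 := hb.pos
  have hP := cast_prime_sq (p := p)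
  have hA := prime_mul_modHarmonic hp (a := a) ha0 (by omega)
  have key : modProduct p a b = ∑ i ∈ Finset.Icc 1 (p - 1),
      (modHarmonic p a (p - 1) * modHarmonic p b i - modHarmonic p a i * modHarmonic p b i -
        p * (a * (modHarmonic p (a + 1) i * modHarmonic p b i) +
          b * (modHarmonic p a i * modHarmonic p (b + 1) i))) := by
    -- Adding the zero term i = 0 makes the range stable under i ↦ p - 1 - i.
    have hr (f : ℕ → ZMod (p ^ 2)) (hf : f 0 = 0) :
        ∑ i ∈ Finset.Icc 1 (p - 1), f i = ∑ i ∈ Finset.range p, f i := by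
      have : Finset.Icc 1 (p - 1) = Finset.Ico 1 p := by ext; simp; omega
      rw [this, Finset.range_eq_Ico, Finset.sum_eq_sum_Ico_succ_bot hp.pos, hf, zero_add]
    rw [modProduct, hr _ (by simp [modHarmonic]), hr _ (by simp [modHarmonic]),
      ← Finset.sum_range_reflect]
    refine Finset.sum_congr rfl fun i hi => ?_
    have hi' := Finset.mem_range.1 hi
    rw [modHarmonic_reflect hp a hi', modHarmonic_reflect hp b hi', ha.neg_one_pow, hb.neg_one_pow,
      modHarmonic_eq_zero_of_odd hp hb (by omega)]
    linear_combination b * modHarmonic p (b + 1) i * hA -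
      a * b * modHarmonic p (a + 1) i * modHarmonic p (b + 1) i * hP
  have h0 := sum_modHarmonic hp hb0
  rw [modHarmonic_eq_zero_of_odd hp hb (by omega), modDouble] at h0
  simp only [pow_zero, one_mul] at h0
  rw [Finset.sum_sub_distrib, Finset.sum_sub_distrib, ← Finset.mul_sum, ← Finset.mul_sum, h0,
    Finset.sum_add_distrib, ← Finset.mul_sum, ← Finset.mul_sum] at key
  change modProduct p a b = _ - modProduct p a b -
    p * (a * modProduct p (a + 1) b + b * modProduct p a (b + 1)) at key
  linear_combination key

end Bernoulli

/-! ### Newton's identities and even-weight harmonic numbers modulo p². -/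

section Newton

variable {p : ℕ}

/-- The elementary symmetric functions of a finite family. -/
def elemSymm {σ A : Type*} [Fintype σ] [CommRing A] (x : σ → A) (n : ℕ) : A :=
  ∑ t ∈ Finset.powersetCard n Finset.univ, ∏ i ∈ t, x i

theorem elemSymm_inv {σ A : Type*} [Fintype σ] [DecidableEq σ] [CommRing A] {x y : σ → A}
    (h : ∀ i, x i * y i = 1) {n : ℕ} (hn : n ≤ Fintype.card σ) :
    elemSymm y n * ∏ i, x i = elemSymm x (Fintype.card σ - n) := by
  rw [elemSymm, elemSymm, Finset.sum_mul]
  refine Finset.sum_bij (fun t _ => tᶜ) ?_ ?_ ?_ ?_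
  · intro t ht
    rw [Finset.mem_powersetCard_univ] at ht ⊢
    rw [Finset.card_compl, ht]
  · intro s _ t _ hst
    exact compl_injective hst
  · intro t ht
    rw [Finset.mem_powersetCard_univ] at ht
    refine ⟨tᶜ, ?_, compl_compl t⟩
    rw [Finset.mem_powersetCard_univ, Finset.card_compl, ht]
    omega
  · intro t _
    rw [← Finset.prod_mul_prod_compl t, ← mul_assoc, ← Finset.prod_mul_distrib,
      Finset.prod_eq_one fun i _ => by rw [mul_comm, h], one_mul]

theorem mul_elemSymm {σ A : Type*} [Fintype σ] [CommRing A] (x : σ → A) (n : ℕ) :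
    n * elemSymm x n = (-1) ^ (n + 1) * ∑ a ∈ Finset.HasAntidiagonal.antidiagonal n with a.1 < n,
      (-1) ^ a.1 * elemSymm x a.1 * ∑ i, x i ^ a.2 := by
  have h := congrArg (MvPolynomial.aeval x) (MvPolynomial.mul_esymm_eq_sum σ ℤ n)
  simpa [MvPolynomial.esymm, MvPolynomial.psum, elemSymm] using h

/-- The mixed terms of Newton's identity are products of two multiples of p, hence zero. -/
theorem elemSymm_of_prime_mul_sum_pow (hp : p.Prime) {σ : Type*} [Fintype σ]
    (x : σ → ZMod (p ^ 2)) (h : ∀ n, 0 < n → n < p - 1 → (p : ZMod (p ^ 2)) * ∑ i, x i ^ n = 0)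
    {n : ℕ} (h0 : 0 < n) (hn : n < p - 1) :
    (p : ZMod (p ^ 2)) * elemSymm x n = 0 ∧ n * elemSymm x n = (-1) ^ (n + 1) * ∑ i, x i ^ n := by
  induction n using Nat.strong_induction_on with
  | _ n ih =>
    have key : n * elemSymm x n = (-1) ^ (n + 1) * ∑ i, x i ^ n := by
      rw [mul_elemSymm, Finset.sum_eq_single_of_mem (0, n)]
      · simp [elemSymm]
      · simp [h0]
      · rintro ⟨i, j⟩ hij hne
        simp only [Finset.mem_filter, Finset.HasAntidiagonal.mem_antidiagonal] at hij
        have hi : 0 < i := by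
          rcases Nat.eq_zero_or_pos i with rfl | hi
          · exact absurd (by simpa using hij.1) fun e : j = n => hne (by rw [e])
          · exact hi
        rw [mul_assoc, mul_eq_zero_of_prime_mul hp (ih i hij.2 hi (by omega)).1
          (h j (by omega) (by omega)), mul_zero]
    refine ⟨(isUnit_of_pos_of_lt hp h0 (by omega)).mul_left_cancel ?_, key⟩
    rw [mul_left_comm, key, mul_left_comm, h n h0 hn, mul_zero, mul_zero]

theorem prime_mul_factorial (hp : p.Prime) :
    (p : ZMod (p ^ 2)) * ((p - 1).factorial : ℕ) = -p := by
  have := Fact.mk hp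
  rw [← sub_eq_zero, sub_neg_eq_add, ← mul_add_one, prime_mul_eq_zero_iff hp, map_add, map_natCast,
    map_one, ZMod.wilsons_lemma, neg_add_cancel]

/-- For even `a`, `H_{p-1}^{(a)} ≡ a / (a + 1) * p * B_{p-1-a}` modulo `p ^ 2`. -/
theorem succ_mul_modHarmonic_of_even (hp : p.Prime) {a : ℕ} (ha : Even a) (h0 : 0 < a)
    (h : a + 3 ≤ p) :
    ((a + 1 : ℕ) : ZMod (p ^ 2)) * modHarmonic p a (p - 1) = a * (p * modBernoulli p (p - 1 - a)) := by
  have hodd : Even (p - 1) := by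
    rcases hp.eq_two_or_odd' with h2 | h2
    · omega
    · exact Nat.Odd.sub_odd h2 odd_one
  let x : Fin (p - 1) → ZMod (p ^ 2) := fun i => ((i + 1 : ℕ) : ZMod (p ^ 2))
  let y : Fin (p - 1) → ZMod (p ^ 2) := fun i => ((i + 1 : ℕ) : ZMod (p ^ 2))⁻¹
  have hsum (f : ℕ → ZMod (p ^ 2)) : ∑ i : Fin (p - 1), f (i + 1) = ∑ k ∈ Finset.Icc 1 (p - 1), f k := by
    rw [Fin.sum_univ_eq_sum_range (fun i => f (i + 1)), Finset.range_eq_Ico,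
      Finset.sum_Ico_add' f 0 (p - 1) 1]
    rfl
  have hxy (i) : x i * y i = 1 := mul_inv_of_pos_of_lt hp (Nat.succ_pos _) (by omega)
  have hx (n : ℕ) : ∑ i, x i ^ n = ∑ k ∈ Finset.Icc 1 (p - 1), (k : ZMod (p ^ 2)) ^ n :=
    hsum fun k => (k : ZMod (p ^ 2)) ^ n
  have hy (n : ℕ) : ∑ i, y i ^ n = modHarmonic p n (p - 1) :=
    hsum fun k => (k : ZMod (p ^ 2))⁻¹ ^ n
  have ex := elemSymm_of_prime_mul_sum_pow hp x (fun n hn0 hn => by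
    rw [hx, prime_mul_sum_pow hp, if_neg (Nat.not_dvd_of_pos_of_lt hn0 hn)])
    (n := p - 1 - a) (by omega) (by omega)
  have ey := elemSymm_of_prime_mul_sum_pow hp y (fun n hn0 hn => by
    rw [hy, prime_mul_modHarmonic hp hn0 hn]) (n := a) h0 (by omega)
  have hprod : ∏ i, x i = ((p - 1).factorial : ℕ) := by
    rw [← Finset.prod_range_add_one_eq_factorial, Nat.cast_prod,
      Fin.prod_univ_eq_prod_range (fun i => ((i + 1 : ℕ) : ZMod (p ^ 2)))]
  have hinv := elemSymm_inv hxy (n := a) (by rw [Fintype.card_fin]; omega)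
  rw [hprod, Fintype.card_fin] at hinv
  obtain ⟨z, hz⟩ := exists_eq_prime_mul hp ey.1
  have hfact := prime_mul_factorial hp
  have heven : Even (p - 1 - a) := (Nat.even_sub (by omega)).2 (by simp [hodd, ha])
  have hb : ∑ k ∈ Finset.Icc 1 (p - 1), (k : ZMod (p ^ 2)) ^ (p - 1 - a) =
      p * modBernoulli p (p - 1 - a) := by
    rw [← sum_range_prime_pow hp (by omega), Finset.range_eq_Ico,
      Finset.sum_eq_sum_Ico_succ_bot hp.pos, Nat.cast_zero, zero_pow (by omega), zero_add]
    congr 1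
  rw [hx, hb, heven.add_one.neg_one_pow] at ex
  rw [hy, ha.add_one.neg_one_pow] at ey
  have hcast : ((p - 1 - a : ℕ) : ZMod (p ^ 2)) = p - 1 - a := by
    rw [Nat.cast_sub (by omega), Nat.cast_sub hp.one_le, Nat.cast_one]
  rw [hcast] at ex
  obtain ⟨ex1, ex2⟩ := ex
  have ey2 := ey.2
  -- `elemSymm y a` is a multiple of p, so (p-1)! may be replaced by -1 (Wilson).
  have hE : elemSymm y a = -elemSymm x (p - 1 - a) := by
    rw [hz] at hinv ⊢
    linear_combination z * hfact - hinv
  rw [hE] at ey2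
  push_cast
  linear_combination (a + 1 : ZMod (p ^ 2)) * ey2 - (a : ZMod (p ^ 2)) * ex2 + (a : ZMod (p ^ 2)) * ex1

end Newton

/-! ### Assembly of the two congruences. -/

section Main

variable {p : ℕ}

theorem prime_mul_modProduct (hp : p.Prime) {a b : ℕ} (h : a + b + 3 ≤ p) :
    (p : ZMod (p ^ 2)) * modProduct p (a + 1) (b + 1) =
      -(p * modDouble p a (b + 1) + p * modDouble p b (a + 1)) := by
  rw [modProduct_succ_succ hp]
  have h1 := prime_mul_modHarmonic hp (a := a + b + 1) (by omega) (by omega)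
  linear_combination h1 + modHarmonic p (a + 1) (p - 1) * modHarmonic p (b + 1) (p - 1) *
    cast_prime_sq (p := p)

/-- The case `b = 1` is the one where the two summands do not vanish separately. -/
theorem boundary_term (hp : p.Prime) {a b : ℕ} (ha : Even a) (hb : Odd b) (h0 : 0 < a)
    (h : a + b + 2 ≤ p) :
    ((a + b : ℕ) : ZMod (p ^ 2)) * (a * (p * modDouble p (b - 1) (a + 1)) -
      modHarmonic p a (p - 1) * modHarmonic p (b - 1) (p - 1)) =
        a * ((a + b).choose (a + 1) : ℕ) * (p * modBernoulli p (p - a - b)) := by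
  obtain ⟨c, rfl⟩ := hb
  rw [Nat.add_sub_cancel]
  rcases Nat.eq_zero_or_pos c with rfl | hc
  -- For b = 1 the factor H_{p-1}^(0) = p - 1 is a unit.
  · have h1 := succ_mul_modHarmonic_of_even hp ha h0 (by omega)
    have h2 := prime_mul_modHarmonic hp (a := a) h0 (by omega)
    have h3 : modHarmonic p 0 (p - 1) = p - 1 := by
      simp [modHarmonic, Nat.cast_sub hp.one_le]
    rw [mul_zero, sum_modHarmonic hp (Nat.succ_pos a), Nat.succ_sub_one, h3]
    have e : p - a - (0 + 1) = p - 1 - a := by omega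
    rw [e, zero_add, Nat.choose_self]
    push_cast at h1 ⊢
    linear_combination h1 - (a + 1) * (a + 1) * h2 +
      (a + 1) * a * modHarmonic p (a + 1) (p - 1) * cast_prime_sq (p := p)
  · have h1 := add_mul_prime_mul_modDouble hp (x := 2 * c) (d := a + 1) (by omega) (by omega) (by omega)
    have h2 := mul_eq_zero_of_prime_mul hp (prime_mul_modHarmonic hp (a := a) h0 (by omega))
      (prime_mul_modHarmonic hp (a := 2 * c) (by omega) (by omega))
    rw [(even_two_mul c).neg_one_pow, show p - 2 * c - (a + 1) = p - a - (2 * c + 1) by omega,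
      show 2 * c + (a + 1) = a + (2 * c + 1) by omega] at h1
    linear_combination (a : ZMod (p ^ 2)) * h1 - ((a + (2 * c + 1) : ℕ) : ZMod (p ^ 2)) * h2

/-- Pascal's rule, together with (a+1) C(a+b+1, a+1) = (b+1) C(a+b+1, a). -/
theorem kCoeff_identity (a b : ℕ) :
    (a * ((a + b).choose b + (a + b).choose (a + 1)) - b * ((a + b).choose (b + 1) + (a + b).choose a) : ℤ) =
      (a + b + 1).choose a - (a + b + 1).choose b := by
  have h1 : ((a + b + 1).choose b : ℤ) = (a + b).choose a + (a + b).choose (a + 1) := by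
    rw [← Nat.choose_symm_of_eq_add (by omega : a + b + 1 = (a + 1) + b), Nat.choose_succ_succ]
    push_cast; rfl
  have h2 : ((a + b + 1).choose a : ℤ) = (a + b).choose b + (a + b).choose (b + 1) := by
    rw [← Nat.choose_symm_of_eq_add (by omega : a + b + 1 = (b + 1) + a), Nat.choose_succ_succ]
    push_cast; rfl
  have h3 : ((a + b).choose a : ℤ) = (a + b).choose b := by
    rw [Nat.choose_symm_add]
  have h4 : ((a + b + 1).choose b : ℤ) * (a + 1) = (a + b + 1).choose a * (b + 1) := by
    have := Nat.choose_succ_right_eq (a + b + 1) a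
    rw [show a + b + 1 - a = b + 1 by omega,
      Nat.choose_symm_of_eq_add (by omega : a + b + 1 = (a + 1) + b)] at this
    exact_mod_cast this
  linear_combination h4 - (a : ℤ) * h1 + (b : ℤ) * h2 - (a + b : ℤ) * h3

theorem modProduct_eq (hp : p.Prime) {a b : ℕ} (ha : Even a) (hb : Odd b) (h0 : 0 < a)
    (h : a + b + 2 ≤ p) :
    ((2 * (a + b) : ℕ) : ZMod (p ^ 2)) * modProduct p a b =
      -(kCoeff a b * (p * modBernoulli p (p - a - b))) := by
  have hb0 := hb.pos
  have h1 := two_mul_modProduct hp ha hb h0 h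
  have h2 := boundary_term hp ha hb h0 h
  have h3 := prime_mul_modProduct hp (a := a) (b := b - 1) (by omega)
  have h4 := prime_mul_modProduct hp (a := a - 1) (b := b) (by omega)
  rw [Nat.sub_add_cancel hb0] at h3
  rw [Nat.sub_add_cancel h0] at h4
  have h5 := add_mul_prime_mul_modDouble hp (x := a) (d := b) h0 hb0 h
  have h6 := add_mul_prime_mul_modDouble hp (x := b) (d := a) hb0 h0 (by omega)
  -- Evenness of a > 0 ensures a - 1 > 0.
  have h7 := add_mul_prime_mul_modDouble hp (x := a - 1) (d := b + 1)
    (by obtain ⟨c, rfl⟩ := ha; omega) (by omega) (by omega)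
  rw [ha.neg_one_pow] at h5
  rw [hb.neg_one_pow, show p - b - a = p - a - b by omega, add_comm b a] at h6
  rw [(Nat.Even.sub_odd h0 ha odd_one).neg_one_pow, show p - (a - 1) - (b + 1) = p - a - b by omega,
    show a - 1 + (b + 1) = a + b by omega] at h7
  have h8 := congrArg (Int.cast : ℤ → ZMod (p ^ 2)) (kCoeff_identity a b)
  rw [kCoeff, ha.neg_one_pow]
  push_cast at *
  linear_combination (a + b : ZMod (p ^ 2)) * h1 + h2 - (a + b : ZMod (p ^ 2)) * a * h3 -
    (a + b : ZMod (p ^ 2)) * b * h4 + a * h5 + b * h6 + b * h7 +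
    p * modBernoulli p (p - a - b) * h8

theorem reducesTo_genHarmonic (hp : p.Prime) (a : ℕ) {i : ℕ} (hi : i < p) :
    ReducesTo p (genHarmonic a i) (modHarmonic p a i) := by
  refine ReducesTo.sum fun k hk => ?_
  have hk' := Finset.mem_Icc.1 hk
  have := (ReducesTo.inv_natCast (by omega) (coprime_of_pos_of_lt hp hk'.1 (by omega))).pow a
  simpa using this

theorem reducesTo_sum_genHarmonic_mul (hp : p.Prime) (a b : ℕ) :
    ReducesTo p (∑ i ∈ Finset.Icc 1 (p - 1), genHarmonic a i * genHarmonic b i)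
      (modProduct p a b) := by
  refine ReducesTo.sum fun i hi => ?_
  have hi' : i < p := by have := Finset.mem_Icc.1 hi; omega
  exact (reducesTo_genHarmonic hp a hi').mul (reducesTo_genHarmonic hp b hi')

theorem kCoeff_comm {a b : ℕ} (h : Even a ↔ Odd b) : kCoeff b a = kCoeff a b := by
  have hs : (-1 : ℤ) ^ b = -(-1) ^ a := by
    rcases Nat.even_or_odd a with ha | ha
    · rw [ha.neg_one_pow, (h.1 ha).neg_one_pow]
    · have hb : Even b := by
        rw [← Nat.not_odd_iff_even, ← h, Nat.not_even_iff_odd]; exact ha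
      rw [ha.neg_one_pow, hb.neg_one_pow, neg_neg]
  rw [kCoeff, kCoeff, hs, add_comm b a]
  ring

theorem reducesTo_bernoulli_side (hp : p.Prime) {a b : ℕ} (ha : Even a) (hb : Odd b)
    (h0 : 0 < a) (h : a + b + 2 ≤ p) :
    ReducesTo p (-((kCoeff a b : ℚ) / (2 * ((a : ℚ) + (b : ℚ)))) * (p : ℚ) * bernoulli (p - a - b))
      (modProduct p a b) := by
  have hcop : (2 * (a + b)).Coprime p :=
    (coprime_of_pos_of_lt hp two_pos (by omega)).mul_left (coprime_of_pos_of_lt hp (by omega) (by omega))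
  have hr := ((((ReducesTo.intCast (p := p) (kCoeff a b)).mul
    (ReducesTo.inv_natCast (by omega) hcop)).neg).mul (ReducesTo.natCast p)).mul
    (reducesTo_bernoulli hp (n := p - a - b) (by have := hb.pos; omega))
  have hu := ZMod.inv_mul_of_unit _ (isUnit_natCast_of_coprime hcop)
  have hm := modProduct_eq hp ha hb h0 h
  convert hr using 1
  · push_cast
    rw [div_eq_mul_inv]
  · linear_combination (((2 * (a + b) : ℕ) : ZMod (p ^ 2))⁻¹) * hm - modProduct p a b * hu

end Main

theorem mainTheorem8 (p : ℕ) (hp : p.Prime) :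
    (∀ a : ℕ, 0 < a → 2 * a + 2 ≤ p →
      RatCongr (p ^ 2)
        (∑ i ∈ Finset.Icc 1 (p - 1), (genHarmonic (a : ℤ) i) ^ 2)
        (-2 * ∑ i ∈ Finset.Icc 1 (p - 1), (i : ℚ) ^ (-(a : ℤ) + 1) * genHarmonic (a : ℤ) i)) ∧
    (∀ a b : ℕ, 0 < a → 0 < b → (Even a ↔ Odd b) → a + b + 2 ≤ p →
      RatCongr (p ^ 2)
        (∑ i ∈ Finset.Icc 1 (p - 1), genHarmonic (a : ℤ) i * genHarmonic (b : ℤ) i)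
        (-((kCoeff a b : ℚ) / (2 * ((a : ℚ) + (b : ℚ)))) * (p : ℚ) * bernoulli (p - a - b))) := by
  constructor
  · intro a ha h
    obtain ⟨c, rfl⟩ : ∃ c, a = c + 1 := ⟨a - 1, by omega⟩
    have h1 := reducesTo_sum_genHarmonic_mul hp (c + 1) (c + 1)
    have h2 : ReducesTo p (∑ i ∈ Finset.Icc 1 (p - 1),
        (i : ℚ) ^ (-((c + 1 : ℕ) : ℤ) + 1) * genHarmonic ((c + 1 : ℕ) : ℤ) i)
        (modDouble p c (c + 1)) := by
      refine ReducesTo.sum fun i hi => ?_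
      have hi' := Finset.mem_Icc.1 hi
      refine ReducesTo.mul ?_ (reducesTo_genHarmonic hp _ (by omega))
      have := (ReducesTo.inv_natCast (by omega)
        (coprime_of_pos_of_lt hp hi'.1 (by omega : i < p))).pow c
      rwa [inv_pow, ← zpow_natCast, ← zpow_neg,
        show -(c : ℤ) = -((c + 1 : ℕ) : ℤ) + 1 by push_cast; ring] at this
    have h3 := (ReducesTo.intCast (p := p) (-2)).mul h2
    have hp2 : p ≠ 2 := by omega
    have hodd := hp.odd_of_ne_two hp2
    have h4 : modHarmonic p (c + c + 1) (p - 1) = 0 :=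
      modHarmonic_eq_zero_of_odd hp ⟨c, by ring⟩ (by obtain ⟨t, ht⟩ := hodd; omega)
    have h5 := prime_mul_modHarmonic hp (a := c + 1) (by omega) (by omega)
    have h6 : modProduct p (c + 1) (c + 1) = ((-2 : ℤ) : ZMod (p ^ 2)) * modDouble p c (c + 1) := by
      rw [modProduct_succ_succ hp, h4]
      push_cast
      linear_combination modHarmonic p (c + 1) (p - 1) * h5
    rw [h6] at h1
    rw [Int.cast_neg, Int.cast_ofNat] at h3
    simp only [pow_two (genHarmonic _ _)]
    exact h1.ratCongr h3
  · intro a b ha hb hab h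
    rcases Nat.even_or_odd a with hae | hao
    · exact (reducesTo_sum_genHarmonic_mul hp a b).ratCongr
        (reducesTo_bernoulli_side hp hae (hab.1 hae) ha h)
    · have hbe : Even b := by
        rw [← Nat.not_odd_iff_even, ← hab, Nat.not_even_iff_odd]; exact hao
      have h1 := reducesTo_sum_genHarmonic_mul hp a b
      rw [modProduct_comm] at h1
      have h2 := reducesTo_bernoulli_side hp hbe hao hb (by omega)
      rw [kCoeff_comm hab, show p - b - a = p - a - b by omega, add_comm (b : ℚ)] at h2
      exact h1.ratCongr h2
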